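/- Let $K_{n\times g}$ denote the complete multipartite graph with $n$ parts of size $g$: its vertex set is $[n]\times[g]$, its parts are $P_x=\{x\}\times[g]$ for $x\in[n]$, and two vertices are adjacent if and only if they lie in different parts. A one-factor is a spanning $1$-regular subgraph, and a one-factorization is a set of one-factors such that every edge lies in exactly one of them. Two edges are parallel if they are vertex-disjoint and join the same pair of parts. An $\mathrm{OF}(n,g)$ is a one-factorization of $K_{n\times g}$ in which no one-factor contains two parallel edges (equivalently, each one-factor, read as a set of words of length $n$ and weight two over an alphabet of size $g+1$, has minimum Hamming distance at least $3$). Let $n\ge 2$. (1) For $g=2,3$, an $\mathrm{OF}(n,g)$ exists if and only if $n>g$ and $gn$ is even. (2) Let $g\ge 4$ be even. An $\mathrm{OF}(n,g)$ exists if and only if $n>g$, except possibly for odd $n$ with $g+3\le n\le 2g-3$ and for even $n$ with $g+2\le n\le 4g-4$. (3) Let $g\ge 5$ be odd. An $\mathrm{OF}(n,g)$ exists if and only if $n>g$ and $n$ is even, except possibly for $n\equiv 2\pmod 4$ with $g+1\le n\le 2g-4$ and for $n\equiv 0\pmod 4$ with $g+1\le n\le 4g-4$. (4) Let $g$ be an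 odd prime power. An $\mathrm{OF}(n,g)$ exists if and only if $n>g$ and $n$ is even, except possibly for $n\equiv 2\pmod 4$ with $g+3\le n\le 2g-4$ and for $n\equiv 0\pmod 4$ with $g+3\le n\le 4g-4$. -/

import Mathlib

/-- `H` contains no parallel edges: no two vertex-disjoint edges of `H` join the same pair of
parts `P_x = {x} × [g]` and `P_y = {y} × [g]` of `K_{n×g}` (adjacency in `H` forces `x ≠ y`). -/
def NoParallelEdges {n g : ℕ} (H : (SimpleGraph.completeEquipartiteGraph n g).Subgraph) : Prop :=
  ∀ (x y : Fin n) (a b a' b' : Fin g),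
    H.Adj (x, a) (y, b) → H.Adj (x, a') (y, b') → ¬ (a ≠ a' ∧ b ≠ b')

/-- A family of one-factors (spanning 1-regular subgraphs, that is, perfect matchings) of `G` such
that every edge of `G` lies in exactly one of them. -/
structure IsOneFactorization {V : Type*} (G : SimpleGraph V) (𝓕 : Set G.Subgraph) : Prop where
  isPerfectMatching : ∀ F ∈ 𝓕, F.IsPerfectMatching
  existsUnique_mem : ∀ e ∈ G.edgeSet, ∃! F : G.Subgraph, F ∈ 𝓕 ∧ e ∈ F.edgeSet

/-- There is an `OF(n, g)`: a one-factorization of the complete multipartite graph `K_{n×g}`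
(`n` parts of size `g`) none of whose one-factors contains parallel edges. -/
def ExistsOF (n g : ℕ) : Prop :=
  ∃ 𝓕 : Set (SimpleGraph.completeEquipartiteGraph n g).Subgraph,
    IsOneFactorization (SimpleGraph.completeEquipartiteGraph n g) 𝓕 ∧
      ∀ F ∈ 𝓕, NoParallelEdges F

/-! Necessity: in one factor the `g` edges leaving a part reach `g` distinct other parts, and a
perfect matching needs `gn` even. For existence it suffices to cover every edge by `g(n-1)` factors,
since counting then makes the cover exact (`IsPartnerScheme.injective`).

Edges with distinct labels are grouped by a one-factorization of the complete graph on labels: each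
matching of labels is combined with permutations of the parts, one per label pair, which must be
fixed-point-free and pairwise edge-disjoint. What varies is the source of the permutations and the
treatment of edges with equal labels. For odd `n` and even `g < n`, the permutations are
translations of `ℤ/n` and equal labels are joined by reflections (`existsOF_of_odd`). For even `n`,
each permutation alternates between two one-factors of `K_n` (`exists_isPermArray`); equal labels
use the one-factors themselves, and for odd `g` a dummy label completes the pairing. This works when
`n ≥ 8` and `n > 3⌈g/2⌉` (`ExistsOF.of_even`). For a prime power `g` and `n = g + 1`, a different
construction uses linear forms at the points of a projective line (`existsOF_of_card_field`). Three
small cases are given by explicit base factors. Together these cover more than the stated ranges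
require. -/

/-- A family of partner maps on `V × A` describing a one-factorization without parallel edges of
the complete multipartite graph with parts `{x} × A`. -/
structure IsPartnerScheme {I V A : Type*} (φ : I → V × A → V × A) : Prop where
  invol : ∀ i v, φ i (φ i v) = v
  fst_ne : ∀ i v, (φ i v).1 ≠ v.1
  label_eq : ∀ i x a b, (φ i (x, a)).1 = (φ i (x, b)).1 → a = b
  exists_partner : ∀ v w : V × A, v.1 ≠ w.1 → ∃ i, φ i v = w

theorem IsPartnerScheme.congr {I V A V' A' : Type*} {φ : I → V × A → V × A}
    (h : IsPartnerScheme φ) (e : V ≃ V') (f : A ≃ A') :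
    IsPartnerScheme (fun i v => (Prod.map e f) (φ i (Prod.map e.symm f.symm v))) where
  invol i v := by
    have : Prod.map e.symm f.symm (Prod.map e f (φ i (Prod.map e.symm f.symm v)))
        = φ i (Prod.map e.symm f.symm v) := by ext <;> simp
    simp only [this, h.invol]
    ext <;> simp
  fst_ne i v := by
    have := h.fst_ne i (Prod.map e.symm f.symm v)
    intro h'
    apply this
    rw [Prod.map_fst, ← Equiv.eq_symm_apply] at h'
    simpa using h'
  label_eq i x a b hab := by
    have := h.label_eq i (e.symm x) (f.symm a) (f.symm b) (by simpa using hab)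
    simpa using this
  exists_partner v w hvw := by
    obtain ⟨i, hi⟩ := h.exists_partner (Prod.map e.symm f.symm v) (Prod.map e.symm f.symm w)
      (by simpa using hvw)
    refine ⟨i, ?_⟩
    simp only [hi]
    ext <;> simp

/-- With at most as many factors as the degree, covering every edge forces it to be covered once. -/
theorem IsPartnerScheme.injective {I V A : Type*} [Fintype I] [Fintype V] [Fintype A]
    {φ : I → V × A → V × A} (h : IsPartnerScheme φ)
    (hI : Fintype.card I ≤ Fintype.card A * (Fintype.card V - 1)) (v : V × A) :
    Function.Injective (fun i => φ i v) := by
  classical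
  let ψ : I → {y : V // y ≠ v.1} × A := fun i => (⟨(φ i v).1, h.fst_ne i v⟩, (φ i v).2)
  have hs : Function.Surjective ψ := by
    rintro ⟨⟨y, hy⟩, b⟩
    obtain ⟨i, hi⟩ := h.exists_partner v (y, b) hy.symm
    exact ⟨i, by simp [ψ, hi]⟩
  have hc : Fintype.card ({y : V // y ≠ v.1} × A) = Fintype.card A * (Fintype.card V - 1) := by
    rw [Fintype.card_prod, mul_comm, Fintype.card_subtype_compl, Fintype.card_subtype_eq]
  have hb : Function.Bijective ψ :=
    (Fintype.bijective_iff_surjective_and_card ψ).2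
      ⟨hs, le_antisymm (hI.trans hc.ge) (Fintype.card_le_of_surjective ψ hs)⟩
  intro i j hij
  apply hb.1
  simp only at hij
  simp [ψ, hij]

theorem IsPartnerScheme.existsOF_fin {I : Type*} [Fintype I] {n g : ℕ}
    {φ : I → Fin n × Fin g → Fin n × Fin g} (h : IsPartnerScheme φ)
    (hI : Fintype.card I ≤ g * (n - 1)) : ExistsOF n g := by
  have hinj := h.injective (by simpa using hI)
  let F : I → (SimpleGraph.completeEquipartiteGraph n g).Subgraph := fun i =>
    { verts := Set.univ
      Adj := fun v w => φ i v = w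
      adj_sub := by
        rintro v w rfl
        simpa [SimpleGraph.completeEquipartiteGraph] using (h.fst_ne i v).symm
      edge_vert := fun _ => Set.mem_univ _
      symm := ⟨by rintro v w rfl; exact h.invol i v⟩ }
  have hF : ∀ i v w, (F i).Adj v w ↔ φ i v = w := fun _ _ _ => Iff.rfl
  refine ⟨Set.range F, ⟨?_, ?_⟩, ?_⟩
  · rintro _ ⟨i, rfl⟩
    refine ⟨fun v _ => ⟨φ i v, rfl, fun w hw => ((hF i v w).1 hw).symm⟩, fun v => Set.mem_univ v⟩
  · intro e
    induction e with
    | h v w =>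
    intro hvw
    have hvw' : v.1 ≠ w.1 := by
      simpa [SimpleGraph.completeEquipartiteGraph] using hvw
    obtain ⟨i, hi⟩ := h.exists_partner v w hvw'
    refine ⟨F i, ⟨⟨i, rfl⟩, hi⟩, ?_⟩
    rintro _ ⟨⟨j, rfl⟩, hj⟩
    have hj' : φ j v = w := hj
    rw [hinj v (hj'.trans hi.symm : φ j v = φ i v)]
  · rintro _ ⟨i, rfl⟩ x y a b a' b' h1 h2 ⟨h3, -⟩
    rw [hF] at h1 h2
    exact h3 (h.label_eq i x a a' (by rw [h1, h2]))

theorem IsPartnerScheme.existsOF {I V A : Type*} [Fintype I] [Fintype V] [Fintype A] {n g : ℕ}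
    {φ : I → V × A → V × A} (h : IsPartnerScheme φ) (hV : Fintype.card V = n)
    (hA : Fintype.card A = g) (hI : Fintype.card I ≤ g * (n - 1)) : ExistsOF n g :=
  (h.congr (Fintype.equivFinOfCardEq hV) (Fintype.equivFinOfCardEq hA)).existsOF_fin hI

/-! ### Necessary conditions -/

theorem ExistsOF.lt_and_even {n g : ℕ} (hn : 2 ≤ n) (hg : 1 ≤ g) (h : ExistsOF n g) :
    g < n ∧ Even (g * n) := by
  obtain ⟨𝓕, h𝓕, hpar⟩ := h
  let x₀ : Fin n := ⟨0, by omega⟩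
  let x₁ : Fin n := ⟨1, by omega⟩
  let a₀ : Fin g := ⟨0, by omega⟩
  have he : s((x₀, a₀), (x₁, a₀)) ∈ (SimpleGraph.completeEquipartiteGraph n g).edgeSet := by
    simp [SimpleGraph.completeEquipartiteGraph, x₀, x₁]
  obtain ⟨F, ⟨hF, -⟩, -⟩ := h𝓕.existsUnique_mem _ he
  have hpm := h𝓕.isPerfectMatching F hF
  have hsym := hpm.1
  constructor
  · have hex : ∀ a : Fin g, ∃ w, F.Adj (x₀, a) w := fun a => (hsym (hpm.2 (x₀, a))).exists
    choose w hw using hex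
    have hne : ∀ a, (w a).1 ≠ x₀ := fun a => by
      have := (hw a).adj_sub
      simp only [SimpleGraph.completeEquipartiteGraph, SimpleGraph.comap_adj,
        SimpleGraph.top_adj] at this
      exact this.symm
    let ψ : Fin g → {y : Fin n // y ≠ x₀} := fun a => ⟨(w a).1, hne a⟩
    have hψ : Function.Injective ψ := by
      intro a b hab
      have hab' : (w a).1 = (w b).1 := by simpa [ψ] using hab
      by_contra hne'
      -- Two edges from `x₀` into one part must share their end there, against the matching
      -- property.
      refine hpar F hF x₀ (w a).1 a (w a).2 b (w b).2 (hw a) (by rw [hab']; exact hw b)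
        ⟨hne', fun h2 => hne' ?_⟩
      have hwab : w a = w b := Prod.ext hab' h2
      have h1 := (hw a).symm
      have h3 := (hw b).symm
      rw [← hwab] at h3
      have := (hsym (hpm.2 (w a))).unique h1 h3
      simpa using this
    have := Fintype.card_le_of_injective ψ hψ
    rw [Fintype.card_subtype_compl, Fintype.card_subtype_eq] at this
    simp only [Fintype.card_fin] at this
    omega
  · classical
    have : Fintype F.verts := Fintype.ofFinite _
    have h2 := hsym.even_card
    have hv : F.verts = Set.univ := Set.eq_univ_of_forall hpm.2
    have hc : F.verts.toFinset.card = g * n := by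
      rw [Set.toFinset_card, ← Nat.card_eq_fintype_card, Nat.card_coe_set_eq, hv, Set.ncard_univ]
      simp [mul_comm]
    rwa [hc] at h2

/-! ### One-factorizations of complete graphs and pairings of labels -/

/-- The maps `F i` are the partner maps of a one-factorization of the complete graph on `V`. -/
structure IsOneFactorFamily {ι V : Type*} (F : ι → V → V) : Prop where
  invol : ∀ i x, F i (F i x) = x
  apply_ne : ∀ i x, F i x ≠ x
  exists_apply_eq : ∀ x y, x ≠ y → ∃ i, F i x = y
  inj : ∀ i j x, F i x = F j x → i = j

theorem IsOneFactorFamily.congr {ι V ι' V' : Type*} {F : ι → V → V} (h : IsOneFactorFamily F)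
    (e : V ≃ V') (f : ι ≃ ι') :
    IsOneFactorFamily (fun i x => e (F (f.symm i) (e.symm x))) where
  invol i x := by simp [h.invol]
  apply_ne i x h' := h.apply_ne (f.symm i) (e.symm x) (by rw [Equiv.eq_symm_apply]; exact h')
  exists_apply_eq x y hxy := by
    obtain ⟨i, hi⟩ := h.exists_apply_eq (e.symm x) (e.symm y) (by simpa using hxy)
    exact ⟨f i, by simp [hi]⟩
  inj i j x hij := by simpa using h.inj _ _ _ (e.injective hij)

theorem IsOneFactorFamily.card_eq {ι V : Type*} [Fintype ι] [Fintype V] [Nonempty V]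
    {F : ι → V → V} (h : IsOneFactorFamily F) : Fintype.card ι + 1 = Fintype.card V := by
  classical
  obtain ⟨x⟩ := ‹Nonempty V›
  have hb : Function.Bijective (fun i => (⟨F i x, h.apply_ne i x⟩ : {y // y ≠ x})) :=
    ⟨fun i j hij => h.inj i j x (by simpa using hij), fun ⟨y, hy⟩ => by
      obtain ⟨i, hi⟩ := h.exists_apply_eq x y hy.symm
      exact ⟨i, by simp [hi]⟩⟩
  rw [Fintype.card_of_bijective hb, Fintype.card_subtype_compl, Fintype.card_subtype_eq]
  have := Fintype.card_pos_iff.2 ⟨x⟩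
  omega

theorem ZMod.two_mul_half (m : ℕ) : (2 : ZMod (2 * m + 1)) * (m + 1) = 1 := by
  have : ((2 * m + 1 : ℕ) : ZMod (2 * m + 1)) = 0 := ZMod.natCast_self _
  push_cast at this
  linear_combination this

theorem ZMod.eq_of_two_mul_eq {m : ℕ} {x y : ZMod (2 * m + 1)} (h : 2 * x = 2 * y) : x = y := by
  linear_combination (m + 1 : ZMod (2 * m + 1)) * h + (y - x) * ZMod.two_mul_half m

/-- The classical rotational construction: `∞` is joined to `c`, and the other points are reflected
in `c`. It works because 2 is invertible modulo `2m + 1`. -/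
theorem isOneFactorFamily_option_zmod (m : ℕ) :
    IsOneFactorFamily (fun (c : ZMod (2 * m + 1)) (x : Option (ZMod (2 * m + 1))) =>
      match x with
      | none => some c
      | some x => if x = c then none else some (2 * c - x)) where
  invol c x := by
    rcases x with _ | x
    · simp
    · by_cases h : x = c
      · simp [h]
      · have : 2 * c - x ≠ c := fun h' => h (by linear_combination -h')
        simp [h, this]
  apply_ne c x := by
    rcases x with _ | x
    · simp
    · by_cases h : x = c
      · simp [h]
      · have : 2 * c - x ≠ x := fun h' => h (ZMod.eq_of_two_mul_eq (by linear_combination -h'))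
        simp [h, this]
  exists_apply_eq x y hxy := by
    rcases x with _ | x <;> rcases y with _ | y
    · exact absurd rfl hxy
    · exact ⟨y, rfl⟩
    · exact ⟨x, by simp⟩
    · have hxy' : x ≠ y := fun h => hxy (by rw [h])
      have h2 := ZMod.two_mul_half m
      refine ⟨(m + 1) * (x + y), ?_⟩
      have h3 : x ≠ (m + 1) * (x + y) := fun h => hxy' (by linear_combination 2 * h + (x + y) * h2)
      simp only [h3, if_false]
      congr 1
      linear_combination (x + y) * h2
  inj c d x h := by
    rcases x with _ | x
    · simpa using h
    · by_cases h1 : x = c <;> by_cases h2 : x = d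
      · exact h1.symm.trans h2
      · simp [h1] at h
        rw [← h1] at h
        simp [h2] at h
      · simp [h2] at h
        rw [← h2] at h
        simp [h1] at h
      · simp only [h1, h2, if_false, Option.some.injEq] at h
        exact ZMod.eq_of_two_mul_eq (by linear_combination h)

theorem exists_isOneFactorFamily {ι V : Type*} [Fintype ι] [Fintype V] {r : ℕ} (hr : 1 ≤ r)
    (hV : Fintype.card V = 2 * r) (hι : Fintype.card ι + 1 = 2 * r) :
    ∃ F : ι → V → V, IsOneFactorFamily F := by
  obtain ⟨m, rfl⟩ : ∃ m, r = m + 1 := ⟨r - 1, by omega⟩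
  exact ⟨_, (isOneFactorFamily_option_zmod m).congr
    (Fintype.equivOfCardEq (by rw [Fintype.card_option, ZMod.card, hV]; ring))
    (Fintype.equivOfCardEq (by rw [ZMod.card]; omega))⟩

/-- All fixed-point-free involutions of a `2r`-set have cycle type `2^r`, hence are conjugate to the
one that flips the Boolean. -/
theorem exists_equiv_fin_prod_bool {A : Type*} [Fintype A] {r : ℕ} (hA : Fintype.card A = 2 * r)
    {f : A → A} (hf : ∀ a, f (f a) = a) (hne : ∀ a, f a ≠ a) :
    ∃ e : A ≃ Fin r × Bool, ∀ a, f a = e.symm ((e a).1, !(e a).2) := by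
  classical
  let σ : Equiv.Perm A := ⟨f, f, hf, hf⟩
  have hcard : Fintype.card A = Fintype.card (Fin r × Bool) := by simp [hA, mul_comm]
  let e₀ : A ≃ Fin r × Bool := Fintype.equivOfCardEq hcard
  let τ : Equiv.Perm A := e₀.trans
    ((Equiv.prodCongr (Equiv.refl _) Equiv.boolNot).trans e₀.symm)
  have hτ : ∀ a, τ a = e₀.symm ((e₀ a).1, !(e₀ a).2) := fun a => rfl
  have key : ∀ ρ : Equiv.Perm A, (∀ a, ρ (ρ a) = a) → (∀ a, ρ a ≠ a) →
      ρ.cycleType = Multiset.replicate r 2 := by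
    intro ρ h1 h2
    obtain ⟨k, hk⟩ : ∃ k, ρ.cycleType = Multiset.replicate k 2 := by
      refine ⟨_, Multiset.eq_replicate_card.2 fun b hb => ?_⟩
      have hb2 := Equiv.Perm.two_le_of_mem_cycleType hb
      have hd := Equiv.Perm.dvd_of_mem_cycleType hb
      have ho : orderOf ρ ∣ 2 := orderOf_dvd_of_pow_eq_one (by ext a; simp [pow_two, h1])
      exact le_antisymm (Nat.le_of_dvd two_pos (hd.trans ho)) hb2
    have hs := Equiv.Perm.sum_cycleType ρ
    have hsupp : ρ.support = Finset.univ := by ext a; simp [h2]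
    rw [hsupp, Finset.card_univ, hA, hk, Multiset.sum_replicate, smul_eq_mul] at hs
    rw [hk]
    congr 1
    omega
  have hτ1 : ∀ a, τ (τ a) = a := fun a => by simp [hτ]
  have hτ2 : ∀ a, τ a ≠ a := fun a h => by
    rw [hτ, Equiv.symm_apply_eq, Prod.ext_iff] at h
    simp at h
  obtain ⟨c, hc⟩ := isConj_iff.1 (Equiv.Perm.isConj_iff_cycleType_eq.2
    ((key σ hf hne).trans (key τ hτ1 hτ2).symm))
  refine ⟨c.trans e₀, fun a => ?_⟩
  have h1 := congrArg (fun ρ : Equiv.Perm A => ρ (c a)) hc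
  have h2 : c⁻¹ (c a) = a := c.symm_apply_apply a
  simp only [Equiv.Perm.mul_apply, h2] at h1
  rw [hτ] at h1
  simp only [Equiv.symm_trans_apply, Equiv.trans_apply]
  rw [Equiv.eq_symm_apply]
  exact h1

/-! ### Factors joining distinct labels along disjoint permutations -/

/-- The permutations `σ p` act without fixed points and their underlying graphs are edge-disjoint
and without double edges. -/
structure IsDisjointPermFamily {R V : Type*} (σ : R → Equiv.Perm V) : Prop where
  apply_ne : ∀ p x, σ p x ≠ x
  apply_ne_symm : ∀ p q x, σ p x ≠ (σ q).symm x
  inj : ∀ p q x, σ p x = σ q x → p = q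

theorem IsDisjointPermFamily.symm_apply_ne {R V : Type*} {σ : R → Equiv.Perm V}
    (h : IsDisjointPermFamily σ) (p : R) (x : V) : (σ p).symm x ≠ x := fun h' =>
  h.apply_ne p x ((Equiv.symm_apply_eq _).1 h').symm

theorem IsDisjointPermFamily.symm_inj {R V : Type*} {σ : R → Equiv.Perm V}
    (h : IsDisjointPermFamily σ) (p q : R) (x : V) (hx : (σ p).symm x = (σ q).symm x) : p = q :=
  h.inj p q ((σ p).symm x) (by rw [Equiv.apply_symm_apply, hx, Equiv.apply_symm_apply])

/-- `σ p` or its inverse, according to the sign. -/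
def signedPerm {R V : Type*} (σ : R → Equiv.Perm V) (u : R × Bool) : Equiv.Perm V :=
  if u.2 then σ u.1 else (σ u.1).symm

theorem signedPerm_not {R V : Type*} (σ : R → Equiv.Perm V) (p : R) (s : Bool) (x : V) :
    signedPerm σ (p, !s) (signedPerm σ (p, s) x) = x := by
  cases s <;> simp [signedPerm]

theorem IsDisjointPermFamily.signedPerm_ne {R V : Type*} {σ : R → Equiv.Perm V}
    (h : IsDisjointPermFamily σ) (u : R × Bool) (x : V) : signedPerm σ u x ≠ x := by
  obtain ⟨p, s⟩ := u
  cases s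
  · simpa [signedPerm] using h.symm_apply_ne p x
  · simpa [signedPerm] using h.apply_ne p x

theorem IsDisjointPermFamily.signedPerm_inj {R V : Type*} {σ : R → Equiv.Perm V}
    (h : IsDisjointPermFamily σ) (u v : R × Bool) (x : V)
    (hx : signedPerm σ u x = signedPerm σ v x) : u = v := by
  obtain ⟨p, s⟩ := u
  obtain ⟨q, t⟩ := v
  cases s <;> cases t <;> simp only [signedPerm, if_true, Bool.false_eq_true, if_false] at hx
  · rw [h.symm_inj p q x hx]
  · exact absurd hx.symm (h.apply_ne_symm q p x)
  · exact absurd hx (h.apply_ne_symm p q x)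
  · rw [h.inj p q x hx]

/-- The partner map that joins the labels paired by `e` along the permutations `σ p`. -/
def pairFactor {R V A : Type*} (e : A ≃ R × Bool) (σ : R → Equiv.Perm V) (v : V × A) : V × A :=
  (signedPerm σ (e v.2) v.1, e.symm ((e v.2).1, !(e v.2).2))

theorem pairFactor_invol {R V A : Type*} (e : A ≃ R × Bool) (σ : R → Equiv.Perm V) (v : V × A) :
    pairFactor e σ (pairFactor e σ v) = v := by
  obtain ⟨x, a⟩ := v
  have h := signedPerm_not σ (e a).1 (e a).2 x
  simp only [pairFactor, Equiv.apply_symm_apply, Bool.not_not, Prod.mk.eta,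
    Equiv.symm_apply_apply] at h ⊢
  rw [h]

theorem pairFactor_fst_ne {R V A : Type*} (e : A ≃ R × Bool) {σ : R → Equiv.Perm V}
    (h : IsDisjointPermFamily σ) (v : V × A) : (pairFactor e σ v).1 ≠ v.1 :=
  h.signedPerm_ne _ _

theorem pairFactor_label_eq {R V A : Type*} (e : A ≃ R × Bool) {σ : R → Equiv.Perm V}
    (h : IsDisjointPermFamily σ) (x : V) (a b : A)
    (hab : (pairFactor e σ (x, a)).1 = (pairFactor e σ (x, b)).1) : a = b :=
  e.injective (h.signedPerm_inj _ _ x hab)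

theorem exists_labelPairing {J A : Type*} [Fintype J] [Fintype A] {r : ℕ} (hr : 1 ≤ r)
    (hA : Fintype.card A = 2 * r) (hJ : Fintype.card J + 1 = 2 * r) :
    ∃ e : J → (A ≃ Fin r × Bool), ∀ a b, a ≠ b → ∃ j, b = (e j).symm ((e j a).1, !(e j a).2) := by
  obtain ⟨F, hF⟩ := exists_isOneFactorFamily hr hA hJ
  choose e he using fun j => exists_equiv_fin_prod_bool hA (hF.invol j) (hF.apply_ne j)
  refine ⟨e, fun a b hab => ?_⟩
  obtain ⟨j, rfl⟩ := hF.exists_apply_eq a b hab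
  exact ⟨j, he j a⟩

/-! ### Odd number of parts: translations and reflections of `ℤ/(2m+1)` -/

section Circulant

variable {m : ℕ}

/-- Representatives of the nonzero residues modulo `2m + 1` up to sign. -/
def circDiff (i : Fin m) : ZMod (2 * m + 1) := ((i : ℕ) + 1 : ℕ)

theorem circDiff_add_ne (i j : Fin m) : circDiff i + circDiff j ≠ 0 := by
  rw [circDiff, circDiff, ← Nat.cast_add, Ne, ZMod.natCast_eq_zero_iff]
  intro h
  have := Nat.le_of_dvd (by omega) h
  omega

theorem circDiff_ne (i : Fin m) : circDiff i ≠ 0 := fun h =>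
  circDiff_add_ne i i (by rw [h, add_zero])

theorem circDiff_injective : Function.Injective (circDiff (m := m)) := by
  intro i j h
  rw [circDiff, circDiff, ZMod.natCast_eq_natCast_iff', Nat.mod_eq_of_lt (by omega),
    Nat.mod_eq_of_lt (by omega)] at h
  ext
  omega

/-- The sign `±1` of a Boolean. -/
def circSign (s : Bool) : ZMod (2 * m + 1) := if s then 1 else -1

theorem circSign_not (s : Bool) : circSign (m := m) (!s) = -circSign s := by
  cases s <;> simp [circSign]

theorem circSign_mul_self (s : Bool) : circSign (m := m) s * circSign s = 1 := by
  cases s <;> simp [circSign]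

theorem circSign_mul_circDiff_injective {s t : Bool} {i j : Fin m}
    (h : circSign s * circDiff i = circSign t * circDiff j) : i = j ∧ s = t := by
  cases s <;> cases t <;>
    simp only [circSign, if_true, Bool.false_eq_true, if_false] at h
  · exact ⟨circDiff_injective (by linear_combination -h), rfl⟩
  · exact absurd (by linear_combination -h) (circDiff_add_ne i j)
  · exact absurd (by linear_combination h) (circDiff_add_ne i j)
  · exact ⟨circDiff_injective (by linear_combination h), rfl⟩

theorem exists_circSign_mul_circDiff {z : ZMod (2 * m + 1)} (hz : z ≠ 0) :
    ∃ (s : Bool) (i : Fin m), z = circSign s * circDiff i := by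
  have hv : z.val ≠ 0 := fun h => hz ((ZMod.val_eq_zero z).1 h)
  have hlt := ZMod.val_lt z
  have hcast : ((z.val : ℕ) : ZMod (2 * m + 1)) = z := ZMod.natCast_zmod_val z
  by_cases h : z.val ≤ m
  · refine ⟨true, ⟨z.val - 1, by omega⟩, ?_⟩
    simp only [circSign, circDiff, if_true, one_mul]
    rw [Nat.sub_add_cancel (by omega), hcast]
  · refine ⟨false, ⟨2 * m - z.val, by omega⟩, ?_⟩
    have h1 : ((2 * m - z.val + 1 + z.val : ℕ) : ZMod (2 * m + 1)) = 0 := by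
      rw [show 2 * m - z.val + 1 + z.val = 2 * m + 1 by omega]
      exact ZMod.natCast_self _
    rw [Nat.cast_add, hcast] at h1
    simp only [circSign, circDiff, Bool.false_eq_true, if_false]
    linear_combination h1

/-- The translations by `s · circDiff (c + p)`. -/
def circPerm [NeZero m] {r : ℕ} (hr : r ≤ m) (c : Fin m × Bool) (p : Fin r) :
    Equiv.Perm (ZMod (2 * m + 1)) :=
  Equiv.addRight (circSign c.2 * circDiff (c.1 + Fin.castLE hr p))

theorem isDisjointPermFamily_circPerm [NeZero m] {r : ℕ} (hr : r ≤ m) (c : Fin m × Bool) :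
    IsDisjointPermFamily (circPerm hr c) where
  apply_ne p x h := by
    have h1 : circSign c.2 * circDiff (c.1 + Fin.castLE hr p) = 0 := by
      simpa [circPerm] using h
    exact circDiff_ne (c.1 + Fin.castLE hr p)
      (by linear_combination circSign c.2 * h1 - circDiff _ * circSign_mul_self c.2)
  apply_ne_symm p q x h := by
    simp only [circPerm, Equiv.coe_addRight, Equiv.addRight_symm] at h
    exact circDiff_add_ne (c.1 + Fin.castLE hr p) (c.1 + Fin.castLE hr q)
      (by linear_combination circSign c.2 * h - (circDiff (c.1 + Fin.castLE hr p)
            + circDiff (c.1 + Fin.castLE hr q)) * circSign_mul_self c.2)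
  inj p q x h := by
    simp only [circPerm, Equiv.coe_addRight, add_right_inj] at h
    have := (circSign_mul_circDiff_injective h).1
    simpa using this

theorem signedPerm_circPerm [NeZero m] {r : ℕ} (hr : r ≤ m) (c : Fin m × Bool) (u : Fin r × Bool)
    (x : ZMod (2 * m + 1)) : signedPerm (circPerm hr c) u x =
      x + circSign u.2 * (circSign c.2 * circDiff (c.1 + Fin.castLE hr u.1)) := by
  obtain ⟨p, s⟩ := u
  obtain ⟨i, t⟩ := c
  cases s <;> cases t <;> simp [signedPerm, circPerm, circSign, Equiv.addRight_symm]

/-- The factor in which two equal labels are joined by a reflection, and the fixed points of the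
reflections of paired labels are joined to each other. -/
def reflFactor {r : ℕ} (hr : r ≤ m) {A : Type*} (e : A ≃ Fin r × Bool) (k : ZMod (2 * m + 1))
    (v : ZMod (2 * m + 1) × A) : ZMod (2 * m + 1) × A :=
  if 2 * v.1 = k + circSign (e v.2).2 * circDiff (Fin.castLE hr (e v.2).1) then
    (v.1 - circSign (e v.2).2 * circDiff (Fin.castLE hr (e v.2).1),
      e.symm ((e v.2).1, !(e v.2).2))
  else (k + circSign (e v.2).2 * circDiff (Fin.castLE hr (e v.2).1) - v.1, v.2)

theorem circSign_mul_circDiff_ne (s : Bool) (i : Fin m) : circSign s * circDiff i ≠ 0 := fun h =>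
  circDiff_ne i (by linear_combination circSign s * h - circDiff i * circSign_mul_self s)

theorem reflFactor_invol {r : ℕ} (hr : r ≤ m) {A : Type*} (e : A ≃ Fin r × Bool)
    (k : ZMod (2 * m + 1)) (v : ZMod (2 * m + 1) × A) :
    reflFactor hr e k (reflFactor hr e k v) = v := by
  obtain ⟨x, a⟩ := v
  by_cases h : 2 * x = k + circSign (e a).2 * circDiff (Fin.castLE hr (e a).1)
  · have h1 : reflFactor hr e k (x, a) =
        (x - circSign (e a).2 * circDiff (Fin.castLE hr (e a).1),
          e.symm ((e a).1, !(e a).2)) := if_pos h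
    rw [h1, reflFactor]
    simp only [Equiv.apply_symm_apply, circSign_not, Bool.not_not, Prod.mk.eta,
      Equiv.symm_apply_apply]
    rw [if_pos (by linear_combination h)]
    ext <;> simp
  · have h1 : reflFactor hr e k (x, a) =
        (k + circSign (e a).2 * circDiff (Fin.castLE hr (e a).1) - x, a) := if_neg h
    rw [h1, reflFactor]
    simp only
    rw [if_neg (fun h' => h (by linear_combination -h'))]
    ext <;> simp

theorem reflFactor_fst_ne {r : ℕ} (hr : r ≤ m) {A : Type*} (e : A ≃ Fin r × Bool)
    (k : ZMod (2 * m + 1)) (v : ZMod (2 * m + 1) × A) : (reflFactor hr e k v).1 ≠ v.1 := by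
  obtain ⟨x, a⟩ := v
  rw [reflFactor]
  split_ifs with h
  · intro h'
    exact circSign_mul_circDiff_ne (e a).2 (Fin.castLE hr (e a).1) (by linear_combination -h')
  · intro h'
    exact h (by linear_combination -h')

/-- If `s_a d_a` is the signed difference of label `a`, then from `x` this label reaches `k + s_a
d_a - x`, or `k - x` when `x` is the fixed point of its reflection. The signed differences are
distinct and nonzero, and a fixed `x` determines its own, so no target repeats. -/
theorem reflFactor_label_eq {r : ℕ} (hr : r ≤ m) {A : Type*} (e : A ≃ Fin r × Bool)
    (k x : ZMod (2 * m + 1)) (a b : A)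
    (hab : (reflFactor hr e k (x, a)).1 = (reflFactor hr e k (x, b)).1) : a = b := by
  have key : circSign (e a).2 * circDiff (Fin.castLE hr (e a).1)
      = circSign (e b).2 * circDiff (Fin.castLE hr (e b).1) → a = b := by
    intro h
    obtain ⟨h1, h2⟩ := circSign_mul_circDiff_injective h
    exact e.injective (Prod.ext (by simpa using h1) h2)
  simp only [reflFactor] at hab
  split_ifs at hab with h1 h2 h2
  · exact key (by linear_combination h2 - h1)
  · exact absurd (by linear_combination h1 - hab)
      (circSign_mul_circDiff_ne (e b).2 (Fin.castLE hr (e b).1))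
  · exact absurd (by linear_combination h2 + hab)
      (circSign_mul_circDiff_ne (e a).2 (Fin.castLE hr (e a).1))
  · exact key (by linear_combination hab)

end Circulant

/-- An odd number of parts, of even size. -/
theorem existsOF_of_odd {m r : ℕ} (hr : 1 ≤ r) (hrm : r ≤ m) : ExistsOF (2 * m + 1) (2 * r) := by
  have : NeZero m := ⟨by omega⟩
  let J := Fin (2 * r - 1)
  obtain ⟨e, he⟩ := exists_labelPairing (J := J) (A := Fin (2 * r)) hr (by simp)
    (by simp only [J, Fintype.card_fin]; omega)
  -- All `(2r-1)·2m` mixed factors and the `2m+1` reflection factors would be one too many. The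
  -- factor `t₀`, translating label `a` by `-s_a d_a`, is dropped: its edges are those between the
  -- fixed points of the reflections.
  let t₀ : J × (Fin m × Bool) := (⟨0, by omega⟩, (0, false))
  let I := {t : J × (Fin m × Bool) // t ≠ t₀} ⊕ ZMod (2 * m + 1)
  let φ : I → ZMod (2 * m + 1) × Fin (2 * r) → ZMod (2 * m + 1) × Fin (2 * r) :=
    Sum.elim (fun t => pairFactor (e t.1.1) (circPerm hrm t.1.2))
      (fun k => reflFactor hrm (e t₀.1) k)
  have hφ : IsPartnerScheme φ :=
    { invol := by
        rintro (t | k) v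
        · exact pairFactor_invol _ _ v
        · exact reflFactor_invol hrm _ k v
      fst_ne := by
        rintro (t | k) v
        · exact pairFactor_fst_ne _ (isDisjointPermFamily_circPerm hrm _) v
        · exact reflFactor_fst_ne hrm _ k v
      label_eq := by
        rintro (t | k) x a b hab
        · exact pairFactor_label_eq _ (isDisjointPermFamily_circPerm hrm _) x a b hab
        · exact reflFactor_label_eq hrm _ k x a b hab
      exists_partner := by
        rintro ⟨x, a⟩ ⟨y, b⟩ hxy
        simp only at hxy
        by_cases hab : a = b
        · subst hab
          refine ⟨Sum.inr (x + y - circSign (e t₀.1 a).2 *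
            circDiff (Fin.castLE hrm (e t₀.1 a).1)), ?_⟩
          simp only [φ, Sum.elim_inr, reflFactor]
          rw [if_neg (fun h => hxy (by linear_combination h))]
          ext <;> simp
        · obtain ⟨j, hj⟩ := he a b hab
          obtain ⟨s, i, hi⟩ := exists_circSign_mul_circDiff
            (z := circSign (e j a).2 * (y - x)) (fun h => hxy (by
              linear_combination -circSign (e j a).2 * h
                + (y - x) * circSign_mul_self (m := m) (e j a).2))
          by_cases ht : (j, (i - Fin.castLE hrm (e j a).1, s)) = t₀
          · rw [Prod.ext_iff, Prod.ext_iff] at ht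
            obtain ⟨rfl, h2, rfl⟩ := ht
            simp only [t₀, sub_eq_zero] at h2
            have hd : circSign false * circDiff i
                = -circDiff (Fin.castLE hrm (e t₀.1 a).1) := by
              rw [h2]
              simp [circSign, t₀]
            -- This `k` makes `x` the fixed point of the reflection for label `a`.
            refine ⟨Sum.inr (2 * x - circSign (e t₀.1 a).2 *
              circDiff (Fin.castLE hrm (e t₀.1 a).1)), ?_⟩
            simp only [φ, Sum.elim_inr, reflFactor]
            rw [if_pos (by ring), ← hj]
            ext
            · simp only [t₀] at hi hd ⊢
              rw [hd] at hi
              linear_combination -circSign (e _ a).2 * hi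
                + (y - x) * circSign_mul_self (m := m) (e _ a).2
            · rfl
          · refine ⟨Sum.inl ⟨_, ht⟩, ?_⟩
            simp only [φ, Sum.elim_inl, pairFactor]
            rw [signedPerm_circPerm, ← hj]
            ext
            · simp only [sub_add_cancel]
              linear_combination -circSign (e j a).2 * hi
                + (y - x) * circSign_mul_self (m := m) (e j a).2
            · rfl }
  refine hφ.existsOF (by simp) (by simp) ?_
  simp only [I, J, Fintype.card_sum, ZMod.card, Fintype.card_subtype_compl, Fintype.card_subtype_eq,
    Fintype.card_prod, Fintype.card_fin, Fintype.card_bool]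
  obtain ⟨k, rfl⟩ : ∃ k, r = k + 1 := ⟨r - 1, by omega⟩
  obtain ⟨l, rfl⟩ : ∃ l, m = l + 1 := ⟨m - 1, by omega⟩
  simp only [show 2 * (k + 1) - 1 = 2 * k + 1 by omega, Nat.add_sub_cancel]
  have h1 : (2 * k + 1) * ((l + 1) * 2) = 4 * (k * l) + 4 * k + 2 * l + 2 := by ring
  have h2 : 2 * (k + 1) * (2 * (l + 1)) = 4 * (k * l) + 4 * k + 4 * l + 4 := by ring
  rw [h1, h2]
  omega

/-! ### One part more than a prime power -/

/-- The number of parts is a prime power plus one, and the size of the parts is that prime power. -/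
theorem existsOF_of_card_field {K : Type*} [Field K] [Fintype K] :
    ExistsOF (Fintype.card K + 1) (Fintype.card K) := by
  classical
  have hcard : ∀ x : Option K, Fintype.card {y : Option K // y ≠ x} = Fintype.card K := fun x => by
    rw [Fintype.card_subtype_compl, Fintype.card_subtype_eq, Fintype.card_option,
      Nat.add_sub_cancel]
  let e : ∀ x : Option K, {y : Option K // y ≠ x} ≃ K := fun x => Fintype.equivOfCardEq (hcard x)
  -- The linear forms attached to the points of the projective line; any two are independent, so the
  -- two ends of an edge determine `f`.
  let l : Option K → K × K → K := fun x f => x.elim f.1 (fun t => f.2 + t * f.1)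
  let ψ : K × K → ∀ x : Option K, {y : Option K // y ≠ x} → Option K × K := fun f x y =>
    (y, l y f + e y ⟨x, y.2.symm⟩)
  -- In factor `f`, the offset `a - l x f` of the vertex `(x, a)` encodes, through `e x`, the part
  -- of its partner.
  let φ : K × K → Option K × K → Option K × K := fun f v => ψ f v.1 ((e v.1).symm (v.2 - l v.1 f))
  have hφ' : ∀ f x y (hxy : x ≠ y), φ f (x, l x f + e x ⟨y, hxy.symm⟩)
      = (y, l y f + e y ⟨x, hxy⟩) := by
    intro f x y hxy
    change ψ f x ((e x).symm (l x f + e x ⟨y, hxy.symm⟩ - l x f)) = _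
    rw [add_sub_cancel_left, Equiv.symm_apply_apply]
  have hrep : ∀ f (v : Option K × K), ∃ y, ∃ hy : v.1 ≠ y,
      v = (v.1, l v.1 f + e v.1 ⟨y, hy.symm⟩) := by
    rintro f ⟨x, a⟩
    refine ⟨_, ((e x).symm (a - l x f)).2.symm, ?_⟩
    simp
  have hφ : IsPartnerScheme φ :=
    { invol := by
        intro f v
        obtain ⟨y, hy, hv⟩ := hrep f v
        rw [hv, hφ' f v.1 y hy, hφ' f y v.1 hy.symm]
      fst_ne := fun f v => ((e v.1).symm (v.2 - l v.1 f)).2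
      label_eq := by
        intro f x a b hab
        have := (e x).symm.injective (Subtype.ext hab)
        simpa using this
      exists_partner := by
        rintro ⟨x, a⟩ ⟨y, b⟩ (hxy : x ≠ y)
        suffices h : ∃ f, l x f = a - e x ⟨y, hxy.symm⟩ ∧ l y f = b - e y ⟨x, hxy⟩ by
          obtain ⟨f, h1, h2⟩ := h
          refine ⟨f, ?_⟩
          have := hφ' f x y hxy
          rwa [h1, h2, sub_add_cancel, sub_add_cancel] at this
        generalize a - e x ⟨y, hxy.symm⟩ = a'
        generalize b - e y ⟨x, hxy⟩ = b'
        rcases x with _ | x <;> rcases y with _ | y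
        · exact absurd rfl hxy
        · exact ⟨(a', b' - y * a'), by simp [l]⟩
        · exact ⟨(b', a' - x * b'), by simp [l]⟩
        · have hne : x - y ≠ 0 := sub_ne_zero.2 fun h => hxy (by rw [h])
          refine ⟨((a' - b') / (x - y), a' - x * ((a' - b') / (x - y))), ?_, ?_⟩
          · simp [l]
          · simp only [l, Option.elim_some]
            field_simp
            ring }
  exact hφ.existsOF (by simp) rfl (by simp)

/-! ### Two-colourings and one-factorizations with bipartite factors -/

/-- Two fixed-point-free involutions have a common proper 2-colouring. -/
theorem exists_common_coloring {V : Type*} {f g : V → V} (hf : ∀ x, f (f x) = x)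
    (hf' : ∀ x, f x ≠ x) (hg : ∀ x, g (g x) = x) (hg' : ∀ x, g x ≠ x) :
    ∃ β : V → Bool, ∀ x, β (f x) = !β x ∧ β (g x) = !β x := by
  classical
  let φ : Equiv.Perm V := ⟨f, f, hf, hf⟩
  let γ : Equiv.Perm V := ⟨g, g, hg, hg⟩
  have hφ : φ * φ = 1 := by ext x; exact hf x
  have hφi : φ⁻¹ = φ := rfl
  have hγi : γ⁻¹ = γ := rfl
  let h : Equiv.Perm V := φ * γ
  -- Conjugation by `f` inverts `h = f ∘ g`.
  have hconj : ∀ k : ℤ, φ * h ^ k = h ^ (-k) * φ := by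
    intro k
    have h1 : φ * h * φ⁻¹ = h⁻¹ := by
      simp only [h, mul_inv_rev, hφi, hγi]
      rw [← mul_assoc, hφ, one_mul]
    have h2 : φ * h ^ k * φ⁻¹ = h ^ (-k) := by
      rw [← conj_zpow, h1, inv_zpow, zpow_neg]
    rw [← h2, inv_mul_cancel_right]
  have hφh : φ * h = γ := by simp only [h]; rw [← mul_assoc, hφ, one_mul]
  -- `f ∘ h^k` is conjugate to `f` for even `k` and to `g` for odd `k`, so it has no fixed point.
  -- Thus `f` moves every cycle of `h` to a different one, and `g` induces the same map on cycles.
  have hns : ∀ x, ¬ h.SameCycle x (f x) := by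
    rintro x ⟨k, hk⟩
    have hfix : (φ * h ^ k) x = x := by
      rw [Equiv.Perm.mul_apply, hk]
      exact hf x
    obtain ⟨l, rfl | rfl⟩ := Int.even_or_odd' k
    · have h1 : φ * h ^ (2 * l) = (h ^ l)⁻¹ * φ * h ^ l := by
        rw [two_mul, zpow_add, ← mul_assoc, hconj, zpow_neg]
      rw [h1, Equiv.Perm.mul_apply, Equiv.Perm.mul_apply, Equiv.Perm.inv_eq_iff_eq] at hfix
      exact hf' _ hfix
    · have h1 : φ * h ^ (2 * l + 1) = (h ^ l)⁻¹ * γ * h ^ l := by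
        rw [two_mul, add_assoc, add_comm l 1, zpow_add, zpow_add, zpow_one, ← mul_assoc, hconj,
          zpow_neg, mul_assoc, ← mul_assoc φ, hφh, mul_assoc]
      rw [h1, Equiv.Perm.mul_apply, Equiv.Perm.mul_apply, Equiv.Perm.inv_eq_iff_eq] at hfix
      exact hg' _ hfix
  let Q := Quotient (Equiv.Perm.SameCycle.setoid h)
  let q : V → Q := fun x => Quotient.mk _ x
  have hq : ∀ x y, q x = q y ↔ h.SameCycle x y := fun x y => Quotient.eq
  -- Any linear order serves to choose a colour for each of two swapped cycles.
  let _ : LinearOrder Q := IsWellOrder.linearOrder WellOrderingRel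
  have hqh : ∀ x, q (h x) = q x := fun x => (hq _ _).2
    (Equiv.Perm.sameCycle_apply_left.2 (Equiv.Perm.SameCycle.refl h x))
  have hqf : ∀ x y, q x = q y → q (f x) = q (f y) := by
    intro x y hxy
    obtain ⟨k, hk⟩ := (hq _ _).1 hxy
    refine (hq _ _).2 ⟨-k, ?_⟩
    have := congrArg (fun ρ : Equiv.Perm V => ρ x) (hconj k)
    simp only [Equiv.Perm.mul_apply, hk] at this
    exact this.symm
  have hne : ∀ x, q x ≠ q (f x) := fun x hx => hns x ((hq _ _).1 hx)
  have hqg : ∀ x, q (g x) = q (f x) := fun x => by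
    have h1 : g x = f (h x) := (hf _).symm
    rw [h1]
    exact hqf _ _ (hqh x)
  have hlt : ∀ x, decide (q (f x) < q x) = !decide (q x < q (f x)) := by
    intro x
    rcases lt_or_gt_of_ne (hne x) with h1 | h1
    · simp [h1, h1.le]
    · simp [h1, h1.le]
  refine ⟨fun x => decide (q x < q (f x)), fun x => ⟨?_, ?_⟩⟩
  · simp only [hf]
    exact hlt x
  · simp only
    rw [hqg, hqf _ _ (hqg x), hf]
    exact hlt x

/-- A one-factorization of the complete graph on two copies of `ℤ/m`, from a family of involutions
of one copy; fixed points are joined across. -/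
theorem isOneFactorFamily_double {C : Type*} {m : ℕ} {μ : C → ZMod m → ZMod m}
    (hinv : ∀ c x, μ c (μ c x) = x) (hex : ∀ x y, x ≠ y → ∃ c, μ c x = y)
    (hinj : ∀ c d x, μ c x = μ d x → c = d)
    (hfix : (∀ c x, μ c x ≠ x) ∨ ∀ x, ∃ c, μ c x = x) :
    IsOneFactorFamily (Sum.elim
      (fun c (v : ZMod m × Bool) => if μ c v.1 = v.1 then (v.1, !v.2) else (μ c v.1, v.2))
      (fun (d : {d : ZMod m // d ≠ 0 ∨ ∀ c x, μ c x ≠ x}) (v : ZMod m × Bool) =>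
        (if v.2 then v.1 - d.1 else v.1 + d.1, !v.2))) where
  invol := by
    rintro (c | d) ⟨x, s⟩
    · by_cases h : μ c x = x
      · simp [h]
      · simp [h, hinv, Ne.symm h]
    · cases s <;> simp
  apply_ne := by
    rintro (c | d) ⟨x, s⟩
    · by_cases h : μ c x = x <;> simp [h]
    · simp
  exists_apply_eq := by
    rintro ⟨x, s⟩ ⟨y, t⟩ h
    by_cases hst : s = t
    · subst hst
      have hxy : x ≠ y := fun h' => h (by rw [h'])
      obtain ⟨c, hc⟩ := hex x y hxy
      exact ⟨Sum.inl c, by simp [hc, hxy.symm]⟩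
    · obtain rfl : t = !s := by cases s <;> cases t <;> simp_all
      by_cases hD : x ≠ y ∨ ∀ c x, μ c x ≠ x
      · refine ⟨Sum.inr ⟨if s then x - y else y - x, ?_⟩, ?_⟩
        · rcases hD with hD | hD
          · left
            cases s
            · simpa [sub_eq_zero] using hD.symm
            · simpa [sub_eq_zero] using hD
          · exact Or.inr hD
        · cases s <;> simp
      · obtain ⟨hxy, hμ⟩ := not_or.1 hD
        obtain rfl : x = y := not_not.1 hxy
        obtain ⟨c, hc⟩ := (hfix.resolve_left hμ) x
        exact ⟨Sum.inl c, by simp [hc]⟩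
  inj := by
    have key : ∀ c (d : {d : ZMod m // d ≠ 0 ∨ ∀ c x, μ c x ≠ x}) (v : ZMod m × Bool),
        (if μ c v.1 = v.1 then (v.1, !v.2) else (μ c v.1, v.2))
          ≠ (if v.2 then v.1 - d.1 else v.1 + d.1, !v.2) := by
      rintro c ⟨d, hd⟩ ⟨x, s⟩ h
      by_cases hc : μ c x = x
      · rcases hd with hd | hd
        · cases s
          · exact hd (by simpa [hc] using h)
          · exact hd (by simpa [hc, eq_sub_iff_add_eq] using h)
        · exact hd c x hc
      · simp [hc] at h
    rintro (c | d) (c' | d') v h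
    · simp only [Sum.elim_inl] at h
      obtain ⟨x, s⟩ := v
      refine congrArg Sum.inl (hinj c c' x ?_)
      by_cases hc : μ c x = x <;> by_cases hc' : μ c' x = x
      · rw [hc, hc']
      · simp [hc, hc'] at h
      · simp [hc, hc'] at h
      · simpa [hc, hc'] using h
    · exact absurd h (key c d' v)
    · exact absurd h.symm (key c' d v)
    · obtain ⟨x, s⟩ := v
      cases s <;> simpa [Subtype.ext_iff] using h

/-- The shifts between two copies of `ℤ/m` swap the copies, so the copy is a common 2-colouring.
Since `m ≥ 4`, the shifts 1, 2, 3 are distinct and nonzero; reindexing puts them at the three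
prescribed places. -/
theorem exists_isOneFactorFamily_bipartite {ι V : Type*} [Fintype ι] [Fintype V] {m : ℕ}
    (hm : 4 ≤ m) (hV : Fintype.card V = 2 * m) (hι : Fintype.card ι + 1 = 2 * m)
    {i₀ : Fin 3 → ι} (hi₀ : Function.Injective i₀) :
    ∃ F : ι → V → V, IsOneFactorFamily F ∧
      ∃ β : V → Bool, ∀ k x, β (F (i₀ k) x) = !β x := by
  classical
  have : NeZero m := ⟨by omega⟩
  obtain ⟨C, _, μ, hinv, hex, hinj, hfix⟩ : ∃ (C : Type) (_ : Fintype C)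
      (μ : C → ZMod m → ZMod m), (∀ c x, μ c (μ c x) = x) ∧ (∀ x y, x ≠ y → ∃ c, μ c x = y) ∧
      (∀ c d x, μ c x = μ d x → c = d) ∧ ((∀ c x, μ c x ≠ x) ∨ ∀ x, ∃ c, μ c x = x) := by
    obtain ⟨l, rfl | rfl⟩ := Nat.even_or_odd' m
    · obtain ⟨F, hF⟩ := exists_isOneFactorFamily (ι := Fin (2 * l - 1)) (V := ZMod (2 * l))
        (r := l) (by omega) (ZMod.card _) (by rw [Fintype.card_fin]; omega)
      exact ⟨_, inferInstance, F, hF.invol, hF.exists_apply_eq, hF.inj, Or.inl hF.apply_ne⟩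
    -- For odd `m` each reflection `x ↦ c - x` has one fixed point; joining it across consumes the
    -- shift 0.
    · refine ⟨ZMod (2 * l + 1), inferInstance, fun c x => c - x, fun c x => by simp,
        fun x y _ => ⟨x + y, by simp⟩, fun c d x h => by simpa using h,
        Or.inr fun x => ⟨x + x, by simp⟩⟩
  have hF := isOneFactorFamily_double hinv hex hinj hfix
  have hcast : ∀ a : ℕ, a < 4 → a ≠ 0 → (a : ZMod m) ≠ 0 := fun a ha ha0 h => by
    rw [ZMod.natCast_eq_zero_iff] at h
    have := Nat.le_of_dvd (Nat.pos_of_ne_zero ha0) h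
    omega
  let D := {d : ZMod m // d ≠ 0 ∨ ∀ c x, μ c x ≠ x}
  let j₀ : Fin 3 → C ⊕ D := fun k => Sum.inr ⟨((k + 1 : ℕ) : ZMod m),
    Or.inl (hcast _ (by omega) (by omega))⟩
  have hj₀ : Function.Injective j₀ := by
    intro a b hab
    have hab' : ((a + 1 : ℕ) : ZMod m) = ((b + 1 : ℕ) : ZMod m) :=
      congrArg Subtype.val (Sum.inr_injective hab)
    rw [ZMod.natCast_eq_natCast_iff', Nat.mod_eq_of_lt (by omega), Nat.mod_eq_of_lt (by omega)]
      at hab'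
    ext
    omega
  have hcard : Fintype.card (C ⊕ D) = Fintype.card ι := by
    have := hF.card_eq
    rw [Fintype.card_prod, ZMod.card, Fintype.card_bool] at this
    change Fintype.card (C ⊕ D) + 1 = _ at this
    omega
  let e₀ : C ⊕ D ≃ ι := Fintype.equivOfCardEq hcard
  have he₀ : Function.Injective (e₀ ∘ j₀) := e₀.injective.comp hj₀
  obtain ⟨π, hπ⟩ : ∃ π : Equiv.Perm ι, ∀ k, π (e₀ (j₀ k)) = i₀ k := by
    let ε : {x // x ∈ Set.range (e₀ ∘ j₀)} ≃ {x // x ∈ Set.range i₀} :=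
      (Equiv.ofInjective _ he₀).symm.trans (Equiv.ofInjective _ hi₀)
    refine ⟨ε.extendSubtype, fun k => ?_⟩
    have h1 := Equiv.extendSubtype_apply_of_mem ε (e₀ (j₀ k)) ⟨k, rfl⟩
    rw [h1]
    change (Equiv.ofInjective _ hi₀ ((Equiv.ofInjective _ he₀).symm
      (Equiv.ofInjective _ he₀ k)) : ι) = i₀ k
    rw [Equiv.symm_apply_apply]
    rfl
  let ev : ZMod m × Bool ≃ V := Fintype.equivOfCardEq (by simp [hV, mul_comm])
  refine ⟨_, hF.congr ev (e₀.trans π), fun x => (ev.symm x).2, fun k x => ?_⟩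
  have h3 : (e₀.trans π).symm (i₀ k) = j₀ k := by
    rw [Equiv.symm_apply_eq, Equiv.trans_apply, hπ]
  rw [h3]
  simp [j₀]

/-- The permutation that follows `f` on one colour class and `g` on the other. -/
def alternatingPerm {V : Type*} (f g : V → V) (β : V → Bool) (hf : ∀ x, f (f x) = x)
    (hg : ∀ x, g (g x) = x) (hβf : ∀ x, β (f x) = !β x) (hβg : ∀ x, β (g x) = !β x) :
    Equiv.Perm V where
  toFun x := if β x then f x else g x
  invFun x := if β x then g x else f x
  left_inv x := by cases h : β x <;> simp [h, hβf, hβg, hf, hg]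
  right_inv x := by cases h : β x <;> simp [h, hβf, hβg, hf, hg]

/-! ### Grouping `2k+3` cyclic positions into one triple and pairs -/

section CyclicArrangement

/-- The positions `0`, `q`, `2q`. -/
def IsTriplePos (q t : ℕ) : Prop := t = 0 ∨ t = q ∨ t = 2 * q

instance (q t : ℕ) : Decidable (IsTriplePos q t) := by unfold IsTriplePos; infer_instance

/-- The rank of a position among the positions other than `0`, `q`, `2q`. -/
def posRank (q t : ℕ) : ℕ := if t < q then t - 1 else if t < 2 * q then t - 2 else t - 3

/-- The position of a given rank. -/
def rankPos (q j : ℕ) : ℕ := if j + 1 < q then j + 1 else if j + 2 < 2 * q then j + 2 else j + 3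

/-- The class of a position among `2k + 3` positions: `0`, `q`, `2q` form the class `0`, and ranks
that differ by `k` form the other classes. -/
def posClass (q k t : ℕ) : ℕ :=
  if IsTriplePos q t then 0 else if posRank q t < k then posRank q t + 1 else posRank q t - k + 1

/-- The next position in the same class. -/
def posNext (q k t : ℕ) : ℕ :=
  if t = 0 then q else if t = q then 2 * q else if t = 2 * q then 0 else
    if posRank q t < k then rankPos q (posRank q t + k) else rankPos q (posRank q t - k)

variable {q k : ℕ}

theorem rankPos_posRank (hq : 1 ≤ q) {t : ℕ} (ht : ¬ IsTriplePos q t) : rankPos q (posRank q t) = t := by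
  unfold IsTriplePos at ht
  unfold posRank rankPos
  split_ifs <;> omega

theorem posRank_rankPos (j : ℕ) : posRank q (rankPos q j) = j := by
  unfold posRank rankPos
  split_ifs <;> omega

theorem not_isTriplePos_rankPos (j : ℕ) : ¬ IsTriplePos q (rankPos q j) := by
  unfold IsTriplePos rankPos
  rintro (h | h | h) <;> split_ifs at h <;> omega

theorem posRank_lt {t : ℕ} (hq : 1 ≤ q) (hqk : 2 * q < 2 * k + 3) (ht : ¬ IsTriplePos q t)
    (htk : t < 2 * k + 3) : posRank q t < 2 * k := by
  unfold IsTriplePos at ht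
  unfold posRank
  split_ifs <;> omega

theorem rankPos_lt {j : ℕ} (hj : j < 2 * k) : rankPos q j < 2 * k + 3 := by
  unfold rankPos
  split_ifs <;> omega

theorem posNext_of_not {t : ℕ} (ht : ¬ IsTriplePos q t) : posNext q k t =
    if posRank q t < k then rankPos q (posRank q t + k) else rankPos q (posRank q t - k) := by
  unfold IsTriplePos at ht
  unfold posNext
  rw [if_neg (by omega), if_neg (by omega), if_neg (by omega)]

theorem not_isTriplePos_posNext {t : ℕ} (ht : ¬ IsTriplePos q t) :
    ¬ IsTriplePos q (posNext q k t) := by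
  rw [posNext_of_not ht]
  split_ifs <;> exact not_isTriplePos_rankPos _

theorem isTriplePos_posNext (hq : 1 ≤ q) {t : ℕ} (ht : IsTriplePos q t) :
    IsTriplePos q (posNext q k t) := by
  unfold IsTriplePos at ht ⊢
  unfold posNext
  split_ifs <;> omega

theorem posRank_posNext {t : ℕ} (ht : ¬ IsTriplePos q t) : posRank q (posNext q k t) =
    if posRank q t < k then posRank q t + k else posRank q t - k := by
  rw [posNext_of_not ht]
  split_ifs <;> exact posRank_rankPos _

theorem posNext_lt (hq : 1 ≤ q) (hqk : 2 * q < 2 * k + 3) {t : ℕ} (htk : t < 2 * k + 3) :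
    posNext q k t < 2 * k + 3 := by
  by_cases ht : IsTriplePos q t
  · have := isTriplePos_posNext (k := k) hq ht
    unfold IsTriplePos at this
    omega
  · have := posRank_lt hq hqk ht htk
    rw [posNext_of_not ht]
    split_ifs <;> exact rankPos_lt (by omega)

theorem posClass_posNext (hq : 1 ≤ q) (hqk : 2 * q < 2 * k + 3) {t : ℕ} (htk : t < 2 * k + 3) :
    posClass q k (posNext q k t) = posClass q k t := by
  by_cases ht : IsTriplePos q t
  · simp [posClass, ht, isTriplePos_posNext (k := k) hq ht]
  · have := posRank_lt hq hqk ht htk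
    simp only [posClass, ht, not_isTriplePos_posNext (k := k) ht, if_false,
      posRank_posNext ht]
    split_ifs <;> omega

theorem posNext_ne (hq : 1 ≤ q) (hk : 1 ≤ k) {t : ℕ} : posNext q k t ≠ t := by
  by_cases ht : IsTriplePos q t
  · unfold IsTriplePos at ht
    unfold posNext
    split_ifs <;> omega
  · intro h
    have := posRank_posNext (k := k) ht
    rw [h] at this
    split_ifs at this <;> omega

theorem posNext_posNext (hq : 1 ≤ q) (hqk : 2 * q < 2 * k + 3) {t : ℕ} (ht : ¬ IsTriplePos q t)
    (htk : t < 2 * k + 3) : posNext q k (posNext q k t) = t := by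
  have := posRank_lt hq hqk ht htk
  rw [posNext_of_not (not_isTriplePos_posNext ht), posRank_posNext ht]
  split_ifs
  · omega
  · rw [Nat.add_sub_cancel, rankPos_posRank hq ht]
  · rw [Nat.sub_add_cancel (by omega), rankPos_posRank hq ht]
  · omega

theorem exists_posNext_eq (hq : 1 ≤ q) (hqk : 2 * q < 2 * k + 3) {t : ℕ} (htk : t < 2 * k + 3) :
    ∃ s < 2 * k + 3, posNext q k s = t := by
  by_cases ht : IsTriplePos q t
  · rcases ht with rfl | rfl | rfl
    · refine ⟨2 * q, hqk, ?_⟩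
      unfold posNext
      split_ifs <;> omega
    · exact ⟨0, by omega, if_pos rfl⟩
    · refine ⟨q, by omega, ?_⟩
      unfold posNext
      split_ifs <;> omega
  · exact ⟨_, posNext_lt hq hqk htk, posNext_posNext hq hqk ht htk⟩

theorem eq_or_eq_posNext_of_posClass_eq (hq : 1 ≤ q) (hqk : 2 * q < 2 * k + 3) {s t : ℕ}
    (htk : t < 2 * k + 3) (hsk : s < 2 * k + 3) (ht : ¬ IsTriplePos q t)
    (hst : posClass q k s = posClass q k t) : s = t ∨ s = posNext q k t := by
  have hs : ¬ IsTriplePos q s := by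
    intro hs
    simp only [posClass, hs, ht, if_true, if_false] at hst
    split_ifs at hst
  have h1 := posRank_lt hq hqk ht htk
  have h2 := posRank_lt hq hqk hs hsk
  simp only [posClass, hs, ht, if_false] at hst
  have h3 := rankPos_posRank hq ht
  have h4 := (rankPos_posRank hq hs).symm
  have h5 := (posNext_of_not (k := k) ht).symm
  split_ifs at hst h5
  · exact Or.inl (h4.trans ((congrArg _ (by omega)).trans h3))
  · exact Or.inr (h4.trans ((congrArg _ (by omega)).trans h5))
  · exact Or.inr (h4.trans ((congrArg _ (by omega)).trans h5))
  · exact Or.inl (h4.trans ((congrArg _ (by omega)).trans h3))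

/-- Members of one class are at cyclic distance at least `r`, so a window of `r` consecutive
positions meets each class at most once. In the triple the gaps are `q`, `q`, `2k+3-2q`; in a pair
the ranks differ by `k` and at most two triple positions intervene. -/
theorem le_sub_of_posClass_eq {r s t : ℕ} (hr : r ≤ q) (hr' : 2 * q + r ≤ 2 * k + 3) (hk : r ≤ k)
    (hq : 1 ≤ q) (hst : t < s) (hsk : s < 2 * k + 3) (h : posClass q k s = posClass q k t) :
    r ≤ s - t ∧ r + (s - t) ≤ 2 * k + 3 := by
  by_cases ht : IsTriplePos q t
  · have hs : IsTriplePos q s := by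
      by_contra hs
      simp only [posClass, hs, ht, if_true, if_false] at h
      split_ifs at h
    unfold IsTriplePos at hs ht
    omega
  · have h1 := eq_or_eq_posNext_of_posClass_eq hq (by omega) (hst.trans hsk) hsk ht h
    have h2 : posRank q t < 2 * k := posRank_lt hq (by omega) ht (hst.trans hsk)
    rcases h1 with rfl | rfl
    · omega
    · rw [posNext_of_not ht] at hst hsk ⊢
      unfold IsTriplePos at ht
      unfold posRank rankPos at *
      split_ifs at * <;> omega

end CyclicArrangement

/-! ### Permutation arrays and an even number of parts -/

/-- A one-factorization together with an array of permutations along its edges: each row `p` of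
the array decomposes the complete digraph, and each column `c` is edge-disjoint, also from the
factor `F (pos c p)` up to the entry in row `p`. -/
structure IsPermArray {ι R V : Type*} (F : ι → V → V) (σ : ι → R → Equiv.Perm V)
    (pos : ι → R → ι) : Prop where
  isDisjoint : ∀ c, IsDisjointPermFamily (σ c)
  exists_apply_eq : ∀ p x y, x ≠ y → ∃ c, σ c p x = y
  eq_of_apply_eq : ∀ c p u x, F (pos c p) x = signedPerm (σ c) u x → u.1 = p
  exists_pos_eq : ∀ p t, ∃ c, pos c p = t

/-- Pairs are coloured by `exists_common_coloring`. A triple of one-factors need not have a common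
2-colouring, so `β₀` is supplied for it. -/
theorem exists_class_coloring {V : Type*} {q k : ℕ} (hq : 1 ≤ q) (hqk : 2 * q < 2 * k + 3)
    {F : Fin (2 * k + 3) → V → V} (hF : IsOneFactorFamily F) {β₀ : V → Bool}
    (hβ₀ : ∀ t : Fin (2 * k + 3), IsTriplePos q t → ∀ x, β₀ (F t x) = !β₀ x) :
    ∃ β : ℕ → V → Bool, ∀ (t : Fin (2 * k + 3)) x,
      β (posClass q k t) (F t x) = !β (posClass q k t) x := by
  suffices h : ∀ κ : ℕ, ∃ b : V → Bool, ∀ t : Fin (2 * k + 3), posClass q k t = κ →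
      ∀ x, b (F t x) = !b x by
    choose β hβ using h
    exact ⟨β, fun t x => hβ _ t rfl x⟩
  intro κ
  by_cases hκ : ∃ t : Fin (2 * k + 3), ¬ IsTriplePos q t ∧ posClass q k t = κ
  · obtain ⟨t, ht, rfl⟩ := hκ
    obtain ⟨b, hb⟩ := exists_common_coloring (hF.invol t) (hF.apply_ne t)
      (hF.invol ⟨_, posNext_lt hq hqk t.2⟩) (hF.apply_ne ⟨_, posNext_lt hq hqk t.2⟩)
    refine ⟨b, fun s hs x => ?_⟩
    rcases eq_or_eq_posNext_of_posClass_eq hq hqk t.2 s.2 ht hs with h | h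
    · rw [Fin.ext h]
      exact (hb x).1
    · rw [show s = ⟨_, posNext_lt hq hqk t.2⟩ from Fin.ext h]
      exact (hb x).2
  · refine ⟨β₀, fun t ht => hβ₀ t ?_⟩
    by_contra h
    exact hκ ⟨t, h, ht⟩

/-- Column `c` consists of the alternating permutations at the `r` cyclic positions from `c` on.
These lie in distinct classes, hence use disjoint sets of one-factors. Each row runs through all
positions. -/
theorem exists_isPermArray {V : Type*} [Fintype V] {k r : ℕ} (hk : 2 ≤ k)
    (hV : Fintype.card V = 2 * k + 4) (hr : 3 * r ≤ 2 * k + 3) :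
    ∃ (F : Fin (2 * k + 3) → V → V) (σ : Fin (2 * k + 3) → Fin r → Equiv.Perm V)
      (pos : Fin (2 * k + 3) → Fin r → Fin (2 * k + 3)),
      IsOneFactorFamily F ∧ IsPermArray F σ pos := by
  -- The triple is spread as evenly as possible; this is where `3r ≤ 2k + 3` enters.
  obtain ⟨q, hrq, hq, hqr, hqk⟩ : ∃ q, r ≤ q ∧ 1 ≤ q ∧ 2 * q + r ≤ 2 * k + 3 ∧ 2 * q < 2 * k + 3 :=
    ⟨(2 * k + 3) / 3, by omega, by omega, by omega, by omega⟩
  obtain ⟨F, hF, β₀, hβ₀⟩ := exists_isOneFactorFamily_bipartite (ι := Fin (2 * k + 3)) (V := V)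
    (m := k + 2) (by omega) (by omega) (by rw [Fintype.card_fin]; omega)
    (i₀ := fun j => ⟨j * q, by nlinarith [j.2]⟩) (by
      intro a b hab
      have h : (a : ℕ) * q = b * q := Fin.mk.inj_iff.1 hab
      exact Fin.ext (Nat.eq_of_mul_eq_mul_right hq h))
  obtain ⟨β, hβ⟩ := exists_class_coloring hq hqk hF (β₀ := β₀) (by
    intro t ht x
    rcases ht with h | h | h
    · rw [show t = ⟨((0 : Fin 3) : ℕ) * q, by simp⟩ from Fin.ext (by simpa using h)]
      exact hβ₀ 0 x
    · rw [show t = ⟨((1 : Fin 3) : ℕ) * q, by simp; omega⟩ from Fin.ext (by simpa using h)]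
      exact hβ₀ 1 x
    · rw [show t = ⟨((2 : Fin 3) : ℕ) * q, by simp; omega⟩ from Fin.ext (by simpa using h)]
      exact hβ₀ 2 x)
  let w : Fin (2 * k + 3) → Fin (2 * k + 3) := fun t => ⟨_, posNext_lt hq hqk t.2⟩
  have hwc : ∀ t, posClass q k (w t) = posClass q k t := fun t => posClass_posNext hq hqk t.2
  have hwne : ∀ t, w t ≠ t := fun t h => posNext_ne hq (by omega) (congrArg Fin.val h)
  have hws : ∀ t, ∃ s, w s = t := fun t => by
    obtain ⟨s, hs, h⟩ := exists_posNext_eq hq hqk t.2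
    exact ⟨⟨s, hs⟩, Fin.ext h⟩
  have hβw : ∀ (t : Fin (2 * k + 3)) x,
      β (posClass q k t) (F (w t) x) = !β (posClass q k t) x := fun t x => by
    rw [← hwc t]
    exact hβ (w t) x
  -- Where `τ t` follows `F t`, its inverse follows `F (w t)`, and conversely. As `w` permutes the
  -- positions, each directed edge of each one-factor is used once.
  let τ : Fin (2 * k + 3) → Equiv.Perm V := fun t =>
    alternatingPerm (F t) (F (w t)) (β (posClass q k t)) (hF.invol _) (hF.invol _) (hβ t) (hβw t)
  have hτ : ∀ t x, τ t x = if β (posClass q k t) x then F t x else F (w t) x := fun _ _ => rfl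
  have hτ' : ∀ t x, (τ t).symm x = if β (posClass q k t) x then F (w t) x else F t x :=
    fun _ _ => rfl
  let pos : Fin (2 * k + 3) → Fin r → Fin (2 * k + 3) := fun c p => c + Fin.castLE (by omega) p
  have hpos : ∀ c p p', posClass q k (pos c p) = posClass q k (pos c p') → p = p' := by
    intro c p p' h
    have hv : ∀ p : Fin r, (pos c p : ℕ) =
        if (c : ℕ) + p < 2 * k + 3 then (c : ℕ) + p else c + p - (2 * k + 3) := by
      intro p
      simp only [pos, Fin.val_add, Fin.val_castLE]
      split_ifs with h'
      · exact Nat.mod_eq_of_lt h'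
      · rw [Nat.mod_eq_sub_mod (by omega), Nat.mod_eq_of_lt (by omega)]
    have h1 := hv p
    have h2 := hv p'
    have hc := c.2
    have hp := p.2
    have hp' := p'.2
    rcases lt_trichotomy (pos c p : ℕ) (pos c p') with h3 | h3 | h3
    · have h4 := le_sub_of_posClass_eq hrq hqr (by omega) hq h3 (pos c p').2 h.symm
      split_ifs at h1 h2 <;> omega
    · ext
      split_ifs at h1 h2 <;> omega
    · have h4 := le_sub_of_posClass_eq hrq hqr (by omega) hq h3 (pos c p).2 h
      split_ifs at h1 h2 <;> omega
  have hsig : ∀ c u x, ∃ t : Fin (2 * k + 3), posClass q k t = posClass q k (pos c u.1) ∧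
      signedPerm (fun p => τ (pos c p)) u x = F t x := by
    rintro c ⟨p, s⟩ x
    cases s
    · simp only [signedPerm, Bool.false_eq_true, if_false, hτ']
      split_ifs
      · exact ⟨_, hwc _, rfl⟩
      · exact ⟨_, rfl, rfl⟩
    · simp only [signedPerm, if_true, hτ]
      split_ifs
      · exact ⟨_, rfl, rfl⟩
      · exact ⟨_, hwc _, rfl⟩
  have hrow : ∀ c u v x, signedPerm (fun p => τ (pos c p)) u x =
      signedPerm (fun p => τ (pos c p)) v x → u.1 = v.1 := by
    intro c u v x h
    obtain ⟨s, hs, hs'⟩ := hsig c u x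
    obtain ⟨t, ht, ht'⟩ := hsig c v x
    rw [hs', ht'] at h
    rw [hF.inj _ _ _ h] at hs
    exact hpos c _ _ (hs.symm.trans ht)
  have hpos_surj : ∀ p t, ∃ c, pos c p = t := fun p t =>
    ⟨t - Fin.castLE (by omega) p, sub_add_cancel _ _⟩
  refine ⟨F, fun c p => τ (pos c p), pos, hF, ?_, ?_, ?_, hpos_surj⟩
  · intro c
    refine ⟨fun p x => ?_, fun p p' x h => ?_, fun p p' x h => ?_⟩
    · rw [hτ]
      split_ifs <;> exact hF.apply_ne _ _
    · obtain rfl : p = p' := hrow c (p, true) (p', false) x (by simpa [signedPerm] using h)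
      rw [hτ, hτ'] at h
      split_ifs at h
      · exact hwne _ (hF.inj _ _ _ h).symm
      · exact hwne _ (hF.inj _ _ _ h)
    · exact hrow c (p, true) (p', true) x (by simpa [signedPerm] using h)
  · intro p x y hxy
    obtain ⟨i, rfl⟩ := hF.exists_apply_eq x y hxy
    by_cases hb : β (posClass q k i) x = true
    · obtain ⟨c, rfl⟩ := hpos_surj p i
      exact ⟨c, by simp only [hτ, hb, if_true]⟩
    · obtain ⟨s, rfl⟩ := hws i
      obtain ⟨c, rfl⟩ := hpos_surj p s
      rw [hwc] at hb
      exact ⟨c, by simp only [hτ, hb]; rfl⟩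
  · intro c p u x h
    obtain ⟨t, ht, ht'⟩ := hsig c u x
    rw [ht'] at h
    rw [← hF.inj _ _ _ h] at ht
    exact hpos c _ _ ht.symm

/-- An even number of parts, of even size. -/
theorem existsOF_of_even_of_even {k r : ℕ} (hr : 1 ≤ r) (hk : 2 ≤ k) (hrk : 3 * r ≤ 2 * k + 3) :
    ExistsOF (2 * k + 4) (2 * r) := by
  obtain ⟨F, σ, pos, hF, hσ⟩ := exists_isPermArray (V := Fin (2 * k + 4)) hk (by simp) hrk
  obtain ⟨e, he⟩ := exists_labelPairing (J := Fin (2 * r - 1)) (A := Fin (2 * r)) hr (by simp)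
    (by rw [Fintype.card_fin]; omega)
  -- Distinct offsets give distinct labels distinct one-factors in every equal-label factor.
  let ℓ : Fin (2 * r) → Fin (2 * k + 3) := Fin.castLE (by omega)
  have hℓ : Function.Injective ℓ := Fin.castLE_injective _
  have hφ : IsPartnerScheme (Sum.elim
      (fun (i : Fin (2 * r - 1) × Fin (2 * k + 3)) => pairFactor (e i.1) (σ i.2))
      (fun (c : Fin (2 * k + 3)) (v : Fin (2 * k + 4) × Fin (2 * r)) =>
        (F (c + ℓ v.2) v.1, v.2))) :=
    { invol := by
        rintro (i | c) v
        · exact pairFactor_invol _ _ v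
        · simp [hF.invol]
      fst_ne := by
        rintro (i | c) v
        · exact pairFactor_fst_ne _ (hσ.isDisjoint _) v
        · exact hF.apply_ne _ _
      label_eq := by
        rintro (i | c) x a b hab
        · exact pairFactor_label_eq _ (hσ.isDisjoint _) x a b hab
        · exact hℓ (add_left_cancel (hF.inj _ _ _ hab))
      exists_partner := by
        rintro ⟨x, a⟩ ⟨y, b⟩ (hxy : x ≠ y)
        by_cases hab : a = b
        · subst hab
          obtain ⟨t, rfl⟩ := hF.exists_apply_eq x y hxy
          exact ⟨Sum.inr (t - ℓ a), by simp⟩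
        · obtain ⟨j, rfl⟩ := he a b hab
          cases hs : (e j a).2
          · obtain ⟨c, rfl⟩ := hσ.exists_apply_eq (e j a).1 y x hxy.symm
            exact ⟨Sum.inl (j, c), by simp [pairFactor, signedPerm, hs]⟩
          · obtain ⟨c, rfl⟩ := hσ.exists_apply_eq (e j a).1 x y hxy
            exact ⟨Sum.inl (j, c), by simp [pairFactor, signedPerm, hs]⟩ }
  refine hφ.existsOF (by simp) (by simp) ?_
  obtain ⟨s, rfl⟩ : ∃ s, r = s + 1 := ⟨r - 1, by omega⟩
  simp only [Fintype.card_sum, Fintype.card_prod, Fintype.card_fin]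
  apply le_of_eq
  rw [show 2 * (s + 1) - 1 = 2 * s + 1 by omega, show 2 * k + 4 - 1 = 2 * k + 3 by omega]
  ring

/-! ### Odd part size: a dummy label -/

/-- The factor in which the label paired with `none` follows `f p`, and the other labels follow
the permutations `σ p`. -/
def pointedFactor {R V A : Type*} (e : Option A ≃ R × Bool) (f : R → V → V)
    (σ : R → Equiv.Perm V) (v : V × A) : V × A :=
  match e.symm ((e (some v.2)).1, !(e (some v.2)).2) with
  | none => (f (e (some v.2)).1 v.1, v.2)
  | some b => (signedPerm σ (e (some v.2)) v.1, b)

section PointedFactor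

variable {R V A : Type*} {e : Option A ≃ R × Bool} {f : R → V → V} {σ : R → Equiv.Perm V}

theorem pointedFactor_of_none {a : A} (h : e.symm ((e (some a)).1, !(e (some a)).2) = none)
    (x : V) : pointedFactor e f σ (x, a) = (f (e (some a)).1 x, a) := by
  simp only [pointedFactor, h]

theorem pointedFactor_of_some {a b : A} (h : e.symm ((e (some a)).1, !(e (some a)).2) = some b)
    (x : V) : pointedFactor e f σ (x, a) = (signedPerm σ (e (some a)) x, b) := by
  simp only [pointedFactor, h]

theorem pointedFactor_invol (hf : ∀ p x, f p (f p x) = x) (v : V × A) :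
    pointedFactor e f σ (pointedFactor e f σ v) = v := by
  obtain ⟨x, a⟩ := v
  rcases h : e.symm ((e (some a)).1, !(e (some a)).2) with _ | b
  · rw [pointedFactor_of_none h, pointedFactor_of_none h, hf]
  · have hb : e (some b) = ((e (some a)).1, !(e (some a)).2) := by
      rw [← h, Equiv.apply_symm_apply]
    have h' : e.symm ((e (some b)).1, !(e (some b)).2) = some a := by
      rw [hb, Equiv.symm_apply_eq]
      simp
    rw [pointedFactor_of_some h, pointedFactor_of_some h', hb]
    exact Prod.ext (signedPerm_not σ _ _ x) rfl

theorem pointedFactor_fst_ne (hf : ∀ p x, f p x ≠ x) (hσ : IsDisjointPermFamily σ) (v : V × A) :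
    (pointedFactor e f σ v).1 ≠ v.1 := by
  obtain ⟨x, a⟩ := v
  rcases h : e.symm ((e (some a)).1, !(e (some a)).2) with _ | b
  · rw [pointedFactor_of_none h]
    exact hf _ _
  · rw [pointedFactor_of_some h]
    exact hσ.signedPerm_ne _ _

/-- The label paired with `none` is the only real label in its row `p`, and `f p` can meet only the
permutation of that row or its inverse. So it cannot reach the same part as another label. -/
theorem pointedFactor_label_eq (hσ : IsDisjointPermFamily σ)
    (hf : ∀ p u x, f p x = signedPerm σ u x → u.1 = p) (x : V) (a b : A)
    (hab : (pointedFactor e f σ (x, a)).1 = (pointedFactor e f σ (x, b)).1) : a = b := by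
  have key : ∀ a b a', e.symm ((e (some a)).1, !(e (some a)).2) = none →
      e.symm ((e (some b)).1, !(e (some b)).2) = some a' →
      (pointedFactor e f σ (x, a)).1 = (pointedFactor e f σ (x, b)).1 → a = b := by
    intro a b a' ha hb hab
    rw [pointedFactor_of_none ha, pointedFactor_of_some hb] at hab
    have h1 := hf _ _ _ hab
    rw [Equiv.symm_apply_eq] at ha hb
    have h2 : (e (some b)).2 = (e (some a)).2 := by
      by_contra h2
      have h3 : e none = e (some b) := by
        rw [← ha]
        exact Prod.ext h1.symm (Bool.eq_not.2 h2).symm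
      simpa using e.injective h3
    simpa using (e.injective (Prod.ext h1 h2)).symm
  rcases ha : e.symm ((e (some a)).1, !(e (some a)).2) with _ | a' <;>
    rcases hb : e.symm ((e (some b)).1, !(e (some b)).2) with _ | b'
  · rw [Equiv.symm_apply_eq] at ha hb
    have := ha.trans hb.symm
    rw [Prod.ext_iff] at this
    simpa using e.injective (Prod.ext this.1 (by simpa using this.2))
  · exact key a b b' ha hb hab
  · exact (key b a a' hb ha hab.symm).symm
  · rw [pointedFactor_of_some ha, pointedFactor_of_some hb] at hab
    simpa using e.injective (hσ.signedPerm_inj _ _ x hab)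

end PointedFactor

/-- An even number of parts, of odd size. -/
theorem existsOF_of_even_of_odd {k r : ℕ} (hk : 2 ≤ k)
    (hrk : 3 * (r + 1) ≤ 2 * k + 3) : ExistsOF (2 * k + 4) (2 * r + 1) := by
  obtain ⟨F, σ, pos, hF, hσ⟩ := exists_isPermArray (V := Fin (2 * k + 4)) hk (by simp) hrk
  obtain ⟨e, he⟩ := exists_labelPairing (J := Fin (2 * r + 1)) (A := Option (Fin (2 * r + 1)))
    (r := r + 1) (by omega) (by rw [Fintype.card_option, Fintype.card_fin]; ring)
    (by rw [Fintype.card_fin]; ring)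
  have hφ : IsPartnerScheme (fun (i : Fin (2 * r + 1) × Fin (2 * k + 3)) =>
      pointedFactor (e i.1) (fun p => F (pos i.2 p)) (σ i.2)) :=
    { invol := fun i v => pointedFactor_invol (e := e i.1) (f := fun p => F (pos i.2 p)) (σ := σ i.2)
        (fun _ _ => hF.invol _ _) v
      fst_ne := fun i v => pointedFactor_fst_ne (fun _ _ => hF.apply_ne _ _) (hσ.isDisjoint _) v
      label_eq := fun i x a b hab => pointedFactor_label_eq (hσ.isDisjoint _)
        (fun p u x h => hσ.eq_of_apply_eq _ p u x h) x a b hab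
      exists_partner := by
        rintro ⟨x, a⟩ ⟨y, b⟩ (hxy : x ≠ y)
        by_cases hab : a = b
        · subst hab
          obtain ⟨j, hj⟩ := he (some a) none (by simp)
          obtain ⟨t, rfl⟩ := hF.exists_apply_eq x y hxy
          obtain ⟨c, rfl⟩ := hσ.exists_pos_eq (e j (some a)).1 t
          exact ⟨(j, c), pointedFactor_of_none hj.symm x⟩
        · obtain ⟨j, hj⟩ := he (some a) (some b) (by simpa using hab)
          cases hs : (e j (some a)).2
          · obtain ⟨c, rfl⟩ := hσ.exists_apply_eq (e j (some a)).1 y x hxy.symm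
            refine ⟨(j, c), ?_⟩
            simp only
            rw [pointedFactor_of_some hj.symm]
            simp [signedPerm, hs]
          · obtain ⟨c, rfl⟩ := hσ.exists_apply_eq (e j (some a)).1 x y hxy
            refine ⟨(j, c), ?_⟩
            simp only
            rw [pointedFactor_of_some hj.symm]
            simp [signedPerm, hs] }
  exact hφ.existsOF (by simp) (by simp) (by simp)

/-! ### Small cases developed cyclically from base factors -/

/-- The translation by `c` of `{0, …, N - 1}` modulo `N`, fixing `N`. -/
def shiftFixingLast {N : ℕ} (c : Fin N) (x : Fin (N + 1)) : Fin (N + 1) :=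
  if x.val = N then x else Fin.ofNat (N + 1) ((x + c) % N)

/-- The translates of base factors. -/
def translatedFactor {N g : ℕ} [NeZero N] (t : Fin g → Fin (N + 1) → Fin g → Fin (N + 1) × Fin g)
    (i : Fin g × Fin N) (v : Fin (N + 1) × Fin g) : Fin (N + 1) × Fin g :=
  Prod.map (shiftFixingLast i.2) id (t i.1 (shiftFixingLast (-i.2) v.1) v.2)

/-- In the table `t i x a` is the partner of `(x, a)` in base factor `i`; the `g` base factors have
`n - 1` translates each, giving the required `g(n-1)`. -/
theorem existsOF_4_2 : ExistsOF 4 2 := by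
  let t : Fin 2 → Fin 4 → Fin 2 → Fin 4 × Fin 2 := ![![![(3, 1), (1, 1)], ![(2, 1), (0, 1)], ![(3, 0), (1, 0)], ![(2, 0), (0, 0)]],
    ![![(1, 0), (3, 1)], ![(0, 0), (2, 0)], ![(1, 1), (3, 0)], ![(2, 1), (0, 1)]]]
  have hφ : IsPartnerScheme (translatedFactor (N := 3) t) :=
    ⟨by decide +kernel, by decide +kernel, by decide +kernel, by decide +kernel⟩
  exact hφ.existsOF (by simp) (by simp) (by simp)

theorem existsOF_6_2 : ExistsOF 6 2 := by
  let t : Fin 2 → Fin 6 → Fin 2 → Fin 6 × Fin 2 := ![![![(2, 0), (3, 0)], ![(2, 1), (4, 1)], ![(0, 0), (1, 0)], ![(0, 1), (5, 0)], ![(5, 1), (1, 1)], ![(3, 1), (4, 0)]],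
    ![![(5, 0), (1, 0)], ![(0, 1), (5, 1)], ![(3, 0), (4, 0)], ![(2, 0), (4, 1)], ![(2, 1), (3, 1)], ![(0, 0), (1, 1)]]]
  have hφ : IsPartnerScheme (translatedFactor (N := 5) t) :=
    ⟨by decide +kernel, by decide +kernel, by decide +kernel, by decide +kernel⟩
  exact hφ.existsOF (by simp) (by simp) (by simp)

theorem existsOF_6_3 : ExistsOF 6 3 := by
  let t : Fin 3 → Fin 6 → Fin 3 → Fin 6 × Fin 3 := ![![![(3, 2), (5, 0), (1, 0)], ![(0, 2), (5, 1), (2, 1)], ![(3, 0), (1, 2), (4, 2)], ![(2, 0), (4, 0), (0, 0)], ![(3, 1), (5, 2), (2, 2)], ![(0, 1), (1, 1), (4, 1)]],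
    ![![(5, 1), (4, 1), (1, 2)], ![(3, 1), (2, 2), (0, 2)], ![(3, 2), (4, 2), (1, 1)], ![(5, 2), (1, 0), (2, 0)], ![(5, 0), (0, 1), (2, 1)], ![(4, 0), (0, 0), (3, 0)]],
    ![![(1, 1), (2, 0), (3, 0)], ![(4, 0), (0, 0), (3, 1)], ![(0, 1), (4, 1), (5, 0)], ![(0, 2), (1, 2), (5, 2)], ![(1, 0), (2, 1), (5, 1)], ![(2, 2), (4, 2), (3, 2)]]]
  have hφ : IsPartnerScheme (translatedFactor (N := 5) t) :=
    ⟨by decide +kernel, by decide +kernel, by decide +kernel, by decide +kernel⟩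
  exact hφ.existsOF (by simp) (by simp) (by simp)

/-! ### Assembly -/

theorem ExistsOF.of_odd_of_even {n g : ℕ} (hg : 1 ≤ g) (hg' : Even g) (hn : Odd n)
    (hgn : g < n) : ExistsOF n g := by
  obtain ⟨m, rfl⟩ := hn
  obtain ⟨r, rfl⟩ := even_iff_exists_two_mul.1 hg'
  exact existsOF_of_odd (by omega) (by omega)

/-- The array needs `⌈g/2⌉` rows, hence `3⌈g/2⌉ ≤ n - 1`; three bipartite shifts need `n/2 ≥ 4`. -/
theorem ExistsOF.of_even {n g : ℕ} (hg : 1 ≤ g) (hn : Even n) (hn' : 8 ≤ n)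
    (hgn : 3 * ((g + 1) / 2) < n) : ExistsOF n g := by
  obtain ⟨k, rfl⟩ : ∃ k, n = 2 * k + 4 := by
    obtain ⟨m, rfl⟩ := hn
    exact ⟨m - 2, by omega⟩
  obtain ⟨r, rfl | rfl⟩ := Nat.even_or_odd' g
  · exact existsOF_of_even_of_even (by omega) (by omega) (by omega)
  · exact existsOF_of_even_of_odd (by omega) (by omega)

theorem ExistsOF.of_isPrimePow {g : ℕ} (hg : IsPrimePow g) : ExistsOF (g + 1) g := by
  obtain ⟨p, k, hp, hk, rfl⟩ := hg
  have : Fact p.Prime := ⟨hp.nat_prime⟩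
  have : Fintype (GaloisField p k) := Fintype.ofFinite _
  have h := existsOF_of_card_field (K := GaloisField p k)
  rwa [← Nat.card_eq_fintype_card, GaloisField.card p k hk.ne'] at h

theorem theorem4 (n g : ℕ) (hn : 2 ≤ n) :
    ((g = 2 ∨ g = 3) → (ExistsOF n g ↔ g < n ∧ Even (g * n))) ∧
    (4 ≤ g → Even g →
      ¬ (Odd n ∧ g + 3 ≤ n ∧ n ≤ 2 * g - 3) →
      ¬ (Even n ∧ g + 2 ≤ n ∧ n ≤ 4 * g - 4) →
      (ExistsOF n g ↔ g < n)) ∧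
    (5 ≤ g → Odd g →
      ¬ (n % 4 = 2 ∧ g + 1 ≤ n ∧ n ≤ 2 * g - 4) →
      ¬ (n % 4 = 0 ∧ g + 1 ≤ n ∧ n ≤ 4 * g - 4) →
      (ExistsOF n g ↔ g < n ∧ Even n)) ∧
    (Odd g → IsPrimePow g →
      ¬ (n % 4 = 2 ∧ g + 3 ≤ n ∧ n ≤ 2 * g - 4) →
      ¬ (n % 4 = 0 ∧ g + 3 ≤ n ∧ n ≤ 4 * g - 4) →
      (ExistsOF n g ↔ g < n ∧ Even n)) := by
  refine ⟨?_, ?_, ?_, ?_⟩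
  · rintro (rfl | rfl)
    · refine ⟨ExistsOF.lt_and_even hn (by norm_num), fun ⟨hlt, _⟩ => ?_⟩
      rcases Nat.even_or_odd n with he | ho
      · by_cases h8 : 8 ≤ n
        · exact ExistsOF.of_even (by norm_num) he h8 (by omega)
        · obtain ⟨m, rfl⟩ := he
          obtain rfl | rfl : m = 2 ∨ m = 3 := by omega
          · exact existsOF_4_2
          · exact existsOF_6_2
      · exact ExistsOF.of_odd_of_even (by norm_num) even_two ho hlt
    · refine ⟨ExistsOF.lt_and_even hn (by norm_num), fun ⟨hlt, he⟩ => ?_⟩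
      have he : Even n := (Nat.even_mul.1 he).resolve_left (by decide)
      by_cases h8 : 8 ≤ n
      · exact ExistsOF.of_even (by norm_num) he h8 (by omega)
      · obtain ⟨m, rfl⟩ := he
        obtain rfl | rfl : m = 2 ∨ m = 3 := by omega
        · exact ExistsOF.of_isPrimePow Nat.prime_three.isPrimePow
        · exact existsOF_6_3
  · intro hg hge h1 h2
    refine ⟨fun h => (h.lt_and_even hn (by omega)).1, fun hlt => ?_⟩
    rcases Nat.even_or_odd n with he | ho
    · have h3 : ¬ (g + 2 ≤ n ∧ n ≤ 4 * g - 4) := fun h => h2 ⟨he, h⟩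
      have h4 : n ≠ g + 1 := by
        rintro rfl
        exact Nat.not_even_iff_odd.2 hge.add_one he
      exact ExistsOF.of_even (by omega) he (by omega) (by omega)
    · exact ExistsOF.of_odd_of_even (by omega) hge ho hlt
  · intro hg hgo h1 h2
    refine ⟨fun h => ?_, fun ⟨hlt, he⟩ => ?_⟩
    · obtain ⟨h3, h4⟩ := h.lt_and_even hn (by omega)
      exact ⟨h3, (Nat.even_mul.1 h4).resolve_left (Nat.not_even_iff_odd.2 hgo)⟩
    -- If `n ≡ 2 (mod 4)` then `n ≥ 2g`, because `2g - 2 ≡ 0 (mod 4)`; and `3(g+1)/2 < 2g` for `g ≥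
    -- 5`.
    · obtain ⟨m, rfl⟩ := id he
      obtain ⟨l, rfl⟩ := id hgo
      exact ExistsOF.of_even (by omega) he (by omega) (by omega)
  · intro hgo hpp h1 h2
    have hg2 := hpp.two_le
    refine ⟨fun h => ?_, fun ⟨hlt, he⟩ => ?_⟩
    · obtain ⟨h3, h4⟩ := h.lt_and_even hn (by omega)
      exact ⟨h3, (Nat.even_mul.1 h4).resolve_left (Nat.not_even_iff_odd.2 hgo)⟩
    · by_cases hn1 : n = g + 1
      · rw [hn1]
        exact ExistsOF.of_isPrimePow hpp
      · obtain ⟨m, rfl⟩ := id he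
        obtain ⟨l, rfl⟩ := id hgo
        -- For `g = 3`, `n = 6` the bound `3(g+1)/2 < n` just fails.
        by_cases h6 : m + m = 6
        · obtain rfl : m = 3 := by omega
          obtain rfl : l = 1 := by omega
          exact existsOF_6_3
        · exact ExistsOF.of_even (by omega) he (by omega) (by omega)
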